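/- Let $A$ be a unital $C^*$-algebra and let $\mathrm{Re}(A)$ be its set of self-adjoint elements. An isocone of $A$ is a subset $I\subset \mathrm{Re}(A)$ such that: (1) $x\cdot 1\in I$ for all $x\in\mathbb{R}$; (2) $b+b'\in I$ for all $b,b'\in I$; (3) $\phi(b)\in I$ (continuous functional calculus) for every $b\in I$ and every continuous non-decreasing function $\phi:\mathbb{R}\to\mathbb{R}$; (4) $I$ is norm-closed; (5) $\overline{\{b-b' : b,b'\in I\}}=\mathrm{Re}(A)$. Theorem. Let $N\ge 3$ be an integer. Then the only isocone of $M_N(\mathbb{C})$ is the set $\mathrm{Herm}(N)$ of all Hermitian $N\times N$ matrices; that is, a subset $I$ of $M_N(\mathbb{C})$ is an isocone if and only if $I=\mathrm{Herm}(N)$. -/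

import Mathlib

/-- A (ultraweak) pre-isocone of a unital C⋆-algebra `A`: a closed set `I` of self-adjoint elements
containing the real constants, stable under sums, and stable under the functional calculus by
continuous non-decreasing functions `ℝ → ℝ`.

The definition only uses the topology, the unital real `⋆`-algebra structure, and the continuous
functional calculus on self-adjoint elements, all of which every unital C⋆-algebra has. For
`A = Matrix (Fin N) (Fin N) ℂ` these are Mathlib's instances: the entrywise topology (which is the
topology of the C⋆-norm, as of any norm) and the functional calculus of Hermitian matrices. -/
structure IsPreIsocone {A : Type*} [Ring A] [StarRing A] [TopologicalSpace A] [Algebra ℝ A]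
    [ContinuousFunctionalCalculus ℝ A IsSelfAdjoint] (I : Set A) : Prop where
  isSelfAdjoint : ∀ b ∈ I, IsSelfAdjoint b
  const_mem : ∀ x : ℝ, algebraMap ℝ A x ∈ I
  add_mem : ∀ b ∈ I, ∀ b' ∈ I, b + b' ∈ I
  cfc_mem : ∀ φ : ℝ → ℝ, Continuous φ → Monotone φ → ∀ b ∈ I, cfc φ b ∈ I
  isClosed : IsClosed I

/-- An (ultraweak) isocone: a pre-isocone such that the closure of the set `I - I` of differences
of elements of `I` is the set of all self-adjoint elements. -/
structure IsIsocone {A : Type*} [Ring A] [StarRing A] [TopologicalSpace A] [Algebra ℝ A]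
    [ContinuousFunctionalCalculus ℝ A IsSelfAdjoint] (I : Set A) : Prop
    extends IsPreIsocone I where
  closure_sub : closure {x : A | ∃ b ∈ I, ∃ b' ∈ I, x = b - b'} = {a : A | IsSelfAdjoint a}

/-- The set of Hermitian `N × N` complex matrices. -/
def Herm (N : ℕ) : Set (Matrix (Fin N) (Fin N) ℂ) := {a | a.IsHermitian}

/-!
The orthogonal projections in a pre-isocone `I` of matrices form a lattice: functional calculus by
monotone step functions extracts extreme spectral projections, and for projections `p`, `q` onto
`K`, `L` the spectral projection of `p + q` at `2` is the projection onto `K ⊓ L`, while its support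
is the projection onto `K ⊔ L`. If `I` is an isocone, it spans the Hermitian matrices, so by
convexity it has an interior point `c` among them. Perturbing `c` so that its top eigenspace becomes
a prescribed line near a top eigenvector `u` shows that the projection onto every line near `u` lies
in `I`. Joins of two such lines give the plane spanned by any `x` and any `v` near `u`; as the
dimension is at least three, two of these planes meet exactly in the line spanned by `x`. Hence `I`
contains all rank one projections, thus all nonnegative matrices, and adding constants gives all
Hermitian matrices.
-/

open Filter Matrix Set Topology
open scoped ComplexOrder MatrixOrder

theorem exists_continuous_monotone_eqOn_of_finite {S : Set ℝ} (hS : S.Finite) {f : ℝ → ℝ}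
    (hf : MonotoneOn f S) : ∃ φ : ℝ → ℝ, Continuous φ ∧ Monotone φ ∧ EqOn φ f S := by
  rcases S.eq_empty_or_nonempty with rfl | hne
  · exact ⟨0, continuous_const, monotone_const, eqOn_empty _ _⟩
  obtain ⟨K, hK, hslope⟩ : ∃ K : ℝ, 0 ≤ K ∧
      ∀ s ∈ S, ∀ t ∈ S, t < s → f s - f t ≤ K * (s - t) := by
    refine ((eventually_ge_atTop 0).and ((eventually_all_finite hS).2 fun s _ =>
      (eventually_all_finite hS).2 fun t _ => ?_)).exists
    filter_upwards [eventually_ge_atTop ((f s - f t) / (s - t))] with K hK hlt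
    exact (div_le_iff₀ (sub_pos.2 hlt)).1 hK
  have hne' : hS.toFinset.Nonempty := hS.toFinset_nonempty.2 hne
  -- One-sided McShane extension: each ramp is monotone in `t` and, since `K` bounds the slopes of
  -- `f` on `S`, never exceeds `f` on `S`.
  refine ⟨fun t => hS.toFinset.sup' hne' fun s => f s - K * max 0 (s - t),
    Continuous.finset_sup'_apply hne' fun s _ => by fun_prop, fun t₁ t₂ h => ?_, fun t ht => ?_⟩
  · exact Finset.sup'_mono_fun fun s _ => by gcongr
  · refine le_antisymm (Finset.sup'_le hne' _ fun s hs => ?_) ?_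
    · have hs : s ∈ S := by simpa using hs
      rcases le_or_gt s t with h | h
      · simpa [h] using hf hs ht h
      · rw [max_eq_right (sub_pos.2 h).le]
        linarith [hslope s hs t ht h]
    · exact Finset.le_sup'_of_le _ (hS.mem_toFinset.2 ht) (by simp)

namespace IsPreIsocone

variable {A : Type*} [Ring A] [StarRing A] [TopologicalSpace A] [Algebra ℝ A]
  [ContinuousFunctionalCalculus ℝ A IsSelfAdjoint] {I : Set A}

theorem smul_mem (hI : IsPreIsocone I) {r : ℝ} (hr : 0 ≤ r) {b : A} (hb : b ∈ I) : r • b ∈ I := by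
  simpa only [cfc_const_mul_id r b (hI.isSelfAdjoint b hb)] using
    hI.cfc_mem (r * ·) (by fun_prop) (monotone_mul_left_of_nonneg hr) b hb

theorem convex (hI : IsPreIsocone I) : Convex ℝ I :=
  fun _ hx _ hy _ _ ha hb _ => hI.add_mem _ (hI.smul_mem ha hx) _ (hI.smul_mem hb hy)

theorem zero_mem (hI : IsPreIsocone I) : (0 : A) ∈ I := by
  simpa using hI.const_mem 0

theorem sum_mem (hI : IsPreIsocone I) {ι : Type*} (s : Finset ι) {b : ι → A}
    (hb : ∀ i ∈ s, b i ∈ I) : ∑ i ∈ s, b i ∈ I :=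
  Finset.sum_induction b (· ∈ I) (fun x y hx hy => hI.add_mem x hx y hy) hI.zero_mem hb

theorem cfc_mem_of_monotoneOn (hI : IsPreIsocone I) {b : A} (hb : b ∈ I)
    (hfin : (spectrum ℝ b).Finite) {f : ℝ → ℝ} (hf : MonotoneOn f (spectrum ℝ b)) :
    cfc f b ∈ I := by
  obtain ⟨φ, hcont, hmono, heq⟩ := exists_continuous_monotone_eqOn_of_finite hfin hf
  rw [← cfc_congr heq]
  exact hI.cfc_mem φ hcont hmono b hb

end IsPreIsocone

theorem isClosed_setOf_isSelfAdjoint {A : Type*} [Star A] [TopologicalSpace A] [T2Space A]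
    [ContinuousStar A] : IsClosed {a : A | IsSelfAdjoint a} :=
  isClosed_eq continuous_star continuous_id

theorem isIsocone_isSelfAdjoint {A : Type*} [Ring A] [StarRing A] [TopologicalSpace A]
    [T2Space A] [ContinuousStar A] [Algebra ℝ A] [StarModule ℝ A]
    [ContinuousFunctionalCalculus ℝ A IsSelfAdjoint] :
    IsIsocone {a : A | IsSelfAdjoint a} where
  isSelfAdjoint _ hb := hb
  const_mem x := .algebraMap A (.all x)
  add_mem _ hb _ hb' := hb.add hb'
  cfc_mem φ _ _ b _ := cfc_predicate φ b
  isClosed := isClosed_setOf_isSelfAdjoint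
  closure_sub := by
    have hsub : {x : A | ∃ b ∈ {a : A | IsSelfAdjoint a}, ∃ b' ∈ {a : A | IsSelfAdjoint a},
        x = b - b'} = {a : A | IsSelfAdjoint a} := by
      ext a
      exact ⟨fun ⟨_, hb, _, hb', h⟩ => h ▸ hb.sub hb',
        fun ha => ⟨a, ha, 0, .zero A, (sub_zero a).symm⟩⟩
    rw [hsub, isClosed_setOf_isSelfAdjoint.closure_eq]

theorem intrinsicInterior_nonempty_of_convex {E : Type*} [AddCommGroup E] [TopologicalSpace E]
    [IsTopologicalAddGroup E] [T2Space E] [Module ℝ E] [ContinuousSMul ℝ E]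
    [FiniteDimensional ℝ E] {s : Set E} (hs : Convex ℝ s) (hne : s.Nonempty) :
    (intrinsicInterior ℝ s).Nonempty := by
  have himage := (intrinsicInterior_nonempty
    (hs.linear_image (toEuclidean (E := E)).toLinearMap)).2 (hne.image _)
  exact image_nonempty.1 <|
    (toEuclidean (E := E)).toContinuousAffineEquiv.intrinsicInterior_image s ▸ himage

namespace IsIsocone

variable {A : Type*} [Ring A] [StarRing A] [TopologicalSpace A] [IsTopologicalAddGroup A]
  [T2Space A] [Algebra ℝ A] [ContinuousSMul ℝ A] [FiniteDimensional ℝ A]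
  [ContinuousFunctionalCalculus ℝ A IsSelfAdjoint] {I : Set A}

theorem isSelfAdjoint_subset_span (hI : IsIsocone I) :
    {a : A | IsSelfAdjoint a} ⊆ Submodule.span ℝ I := by
  rw [← hI.closure_sub]
  refine closure_minimal ?_ (Submodule.closed_of_finiteDimensional _)
  rintro _ ⟨b, hb, b', hb', rfl⟩
  exact sub_mem (Submodule.subset_span hb) (Submodule.subset_span hb')

theorem exists_eventually_isSelfAdjoint_mem (hI : IsIsocone I) :
    ∃ c ∈ I, ∀ᶠ a in 𝓝 c, IsSelfAdjoint a → a ∈ I := by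
  have hzero : (0 : A) ∈ I := hI.zero_mem
  obtain ⟨c, hc⟩ := intrinsicInterior_nonempty_of_convex hI.convex ⟨0, hzero⟩
  obtain ⟨⟨c, hcspan⟩, hcint, rfl⟩ := mem_intrinsicInterior.1 hc
  obtain ⟨U, hU, hUI⟩ := mem_nhds_subtype _ _ _ |>.1 (mem_interior_iff_mem_nhds.1 hcint)
  have hspan : (affineSpan ℝ I : Set A) = Submodule.span ℝ I := by
    rw [← affineSpan_insert_zero, insert_eq_of_mem hzero]
  refine ⟨c, intrinsicInterior_subset hc, ?_⟩
  filter_upwards [hU] with a haU ha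
  have haspan : a ∈ affineSpan ℝ I := by
    rw [← SetLike.mem_coe, hspan]
    exact hI.isSelfAdjoint_subset_span ha
  exact hUI (show (⟨a, haspan⟩ : affineSpan ℝ I) ∈ _ from haU)

end IsIsocone

section ProjMatrix

variable {n 𝕜 : Type*} [Fintype n] [DecidableEq n] [RCLike 𝕜]

/-- The matrix, in the standard basis, of the orthogonal projection onto a subspace `K`. -/
noncomputable def projMatrix (K : Submodule 𝕜 (EuclideanSpace 𝕜 n)) : Matrix n n 𝕜 :=
  (toEuclideanCLM (n := n) (𝕜 := 𝕜)).symm K.starProjection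

/-- The kernel of a matrix as a subspace of Euclidean space, where orthogonal complements make
sense. -/
noncomputable def euclideanKer (A : Matrix n n 𝕜) : Submodule 𝕜 (EuclideanSpace 𝕜 n) :=
  (toEuclideanCLM (n := n) (𝕜 := 𝕜) A).ker

theorem mem_euclideanKer {A : Matrix n n 𝕜} {v : EuclideanSpace 𝕜 n} :
    v ∈ euclideanKer A ↔ A *ᵥ v.ofLp = 0 := by
  rw [euclideanKer, LinearMap.mem_ker, ContinuousLinearMap.coe_coe, ← WithLp.ofLp_eq_zero 2,
    ofLp_toEuclideanCLM]

theorem toEuclideanCLM_projMatrix (K : Submodule 𝕜 (EuclideanSpace 𝕜 n)) :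
    toEuclideanCLM (n := n) (𝕜 := 𝕜) (projMatrix K) = K.starProjection :=
  (toEuclideanCLM (n := n) (𝕜 := 𝕜)).apply_symm_apply _

theorem isStarProjection_projMatrix (K : Submodule 𝕜 (EuclideanSpace 𝕜 n)) :
    IsStarProjection (projMatrix K) :=
  isStarProjection_starProjection.map (toEuclideanCLM (n := n) (𝕜 := 𝕜)).symm

theorem projMatrix_nonneg (K : Submodule 𝕜 (EuclideanSpace 𝕜 n)) : 0 ≤ projMatrix K :=
  (isStarProjection_projMatrix K).nonneg

theorem projMatrix_orthogonal (K : Submodule 𝕜 (EuclideanSpace 𝕜 n)) :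
    projMatrix Kᗮ = 1 - projMatrix K := by
  rw [projMatrix, Submodule.starProjection_orthogonal', map_sub, map_one, projMatrix]

theorem euclideanKer_projMatrix (K : Submodule 𝕜 (EuclideanSpace 𝕜 n)) :
    euclideanKer (projMatrix K) = Kᗮ := by
  rw [euclideanKer, toEuclideanCLM_projMatrix, Submodule.ker_starProjection]

theorem eq_projMatrix_of_isStarProjection {P : Matrix n n 𝕜} (hP : IsStarProjection P) :
    P = projMatrix (euclideanKer (1 - P)) := by
  have hP' := hP.map (toEuclideanCLM (n := n) (𝕜 := 𝕜))
  refine EquivLike.injective (toEuclideanCLM (n := n) (𝕜 := 𝕜)) ?_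
  rw [toEuclideanCLM_projMatrix]
  refine ContinuousLinearMap.IsStarProjection.ext hP' isStarProjection_starProjection ?_
  rw [Submodule.range_starProjection, euclideanKer, map_sub, map_one]
  exact LinearMap.IsIdempotentElem.range_eq_ker_one_sub
    (ContinuousLinearMap.IsIdempotentElem.toLinearMap hP'.isIdempotentElem)

theorem euclideanKer_add {A B : Matrix n n 𝕜} (hA : 0 ≤ A) (hB : 0 ≤ B) :
    euclideanKer (A + B) = euclideanKer A ⊓ euclideanKer B := by
  ext v
  have hA := hA.posSemidef
  have hB := hB.posSemidef
  rw [Submodule.mem_inf, mem_euclideanKer, mem_euclideanKer, mem_euclideanKer,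
    ← hA.dotProduct_mulVec_zero_iff, ← hB.dotProduct_mulVec_zero_iff,
    ← (hA.add hB).dotProduct_mulVec_zero_iff, add_mulVec, dotProduct_add]
  exact add_eq_zero_iff_of_nonneg (hA.dotProduct_mulVec_nonneg _) (hB.dotProduct_mulVec_nonneg _)

theorem euclideanKer_le_mul (A B : Matrix n n 𝕜) : euclideanKer B ≤ euclideanKer (A * B) := by
  intro v hv
  rw [mem_euclideanKer] at hv ⊢
  rw [← mulVec_mulVec, hv, mulVec_zero]

theorem euclideanKer_eq_bot_iff {A : Matrix n n 𝕜} : euclideanKer A = ⊥ ↔ IsUnit A := by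
  rw [← mulVec_injective_iff_isUnit, ← coe_mulVecLin, ← LinearMap.ker_eq_bot,
    ker_mulVecLin_eq_bot_iff, Submodule.eq_bot_iff, (WithLp.equiv 2 (n → 𝕜)).forall_congr_left]
  simp [mem_euclideanKer]

theorem continuousOn_spectrum (f : ℝ → ℝ) (A : Matrix n n 𝕜) : ContinuousOn f (spectrum ℝ A) :=
  A.finite_real_spectrum.continuousOn f

theorem euclideanKer_cfc_le {A : Matrix n n 𝕜} {f g : ℝ → ℝ}
    (h : ∀ t ∈ spectrum ℝ A, f t = 0 → g t = 0) :
    euclideanKer (cfc f A) ≤ euclideanKer (cfc g A) := by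
  have hfactor : (spectrum ℝ A).EqOn g fun t => g t / f t * f t :=
    fun t ht => (div_mul_cancel_of_imp (h t ht)).symm
  rw [cfc_congr hfactor, cfc_mul _ _ A (continuousOn_spectrum _ A) (continuousOn_spectrum _ A)]
  exact euclideanKer_le_mul _ _

theorem cfc_ite_eq_zero (f : ℝ → ℝ) {A : Matrix n n 𝕜} (hA : IsSelfAdjoint A) :
    cfc (fun t => if f t = 0 then (1 : ℝ) else 0) A = projMatrix (euclideanKer (cfc f A)) := by
  set χ : ℝ → ℝ := fun t => if f t = 0 then 1 else 0
  have hproj : IsStarProjection (cfc χ A) := by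
    refine ⟨?_, cfc_predicate χ A⟩
    rw [IsIdempotentElem, ← cfc_mul _ _ A (continuousOn_spectrum _ A) (continuousOn_spectrum _ A)]
    simp [χ, ← ite_and]
  have hcompl : 1 - cfc χ A = cfc (fun t => 1 - χ t) A := by
    rw [cfc_sub _ _ A (continuousOn_spectrum _ A) (continuousOn_spectrum _ A), cfc_const_one ℝ A]
  rw [eq_projMatrix_of_isStarProjection hproj, hcompl]
  congr 1
  exact le_antisymm (euclideanKer_cfc_le fun t _ => by grind)
    (euclideanKer_cfc_le fun t _ => by grind)

theorem exists_le_algebraMap_euclideanKer_ne_bot [Nonempty n] {A : Matrix n n 𝕜}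
    (hA : IsSelfAdjoint A) :
    ∃ l : ℝ, A ≤ algebraMap ℝ _ l ∧ euclideanKer (algebraMap ℝ _ l - A) ≠ ⊥ := by
  obtain ⟨l, hl, hmax⟩ := A.finite_real_spectrum.exists_maximal
    (ContinuousFunctionalCalculus.spectrum_nonempty A hA)
  refine ⟨l, ?_, fun hbot => hl ?_⟩
  · exact le_algebraMap_of_spectrum_le fun t ht => le_of_not_gt fun h => (hmax ht h.le).not_gt h
  · exact euclideanKer_eq_bot_iff.1 hbot

end ProjMatrix

namespace IsPreIsocone

variable {n 𝕜 : Type*} [Fintype n] [DecidableEq n] [RCLike 𝕜] {I : Set (Matrix n n 𝕜)}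

theorem projMatrix_euclideanKer_mem (hI : IsPreIsocone I) {A : Matrix n n 𝕜} (hA : A ∈ I) {l : ℝ}
    (hl : A ≤ algebraMap ℝ _ l) : projMatrix (euclideanKer (algebraMap ℝ _ l - A)) ∈ I := by
  have hsa := hI.isSelfAdjoint A hA
  have hsub : cfc (fun t => l - t) A = algebraMap ℝ _ l - A := by
    rw [cfc_sub _ _ A, cfc_const l A, cfc_id' ℝ A]
  rw [← hsub, ← cfc_ite_eq_zero _ hsa]
  refine hI.cfc_mem_of_monotoneOn hA A.finite_real_spectrum fun s _ t ht hst => ?_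
  have htl : t ≤ l := (le_algebraMap_iff_spectrum_le hsa).1 hl t ht
  grind

theorem projMatrix_orthogonal_euclideanKer_mem (hI : IsPreIsocone I) {A : Matrix n n 𝕜}
    (hA : A ∈ I) (hnonneg : 0 ≤ A) : projMatrix (euclideanKer A)ᗮ ∈ I := by
  have hsa := hI.isSelfAdjoint A hA
  have hcompl : projMatrix (euclideanKer A)ᗮ =
      cfc (fun t => 1 - if t = 0 then (1 : ℝ) else 0) A := by
    rw [cfc_sub _ _ A (continuousOn_spectrum _ A) (continuousOn_spectrum _ A), cfc_const_one ℝ A,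
      cfc_ite_eq_zero (fun t => t) hsa, cfc_id' ℝ A, projMatrix_orthogonal]
  rw [hcompl]
  refine hI.cfc_mem_of_monotoneOn hA A.finite_real_spectrum fun s hs t _ hst => ?_
  have hs0 : 0 ≤ s := spectrum_nonneg_of_nonneg hnonneg hs
  grind

theorem projMatrix_inf_mem (hI : IsPreIsocone I) {K L : Submodule 𝕜 (EuclideanSpace 𝕜 n)}
    (hK : projMatrix K ∈ I) (hL : projMatrix L ∈ I) : projMatrix (K ⊓ L) ∈ I := by
  have hsub : algebraMap ℝ _ 2 - (projMatrix K + projMatrix L) = projMatrix Kᗮ + projMatrix Lᗮ := by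
    rw [projMatrix_orthogonal, projMatrix_orthogonal, map_ofNat, ← one_add_one_eq_two]
    abel
  have hker : euclideanKer (projMatrix Kᗮ + projMatrix Lᗮ) = K ⊓ L := by
    rw [euclideanKer_add (projMatrix_nonneg _) (projMatrix_nonneg _), euclideanKer_projMatrix,
      euclideanKer_projMatrix, Submodule.orthogonal_orthogonal, Submodule.orthogonal_orthogonal]
  rw [← hker, ← hsub]
  refine hI.projMatrix_euclideanKer_mem (hI.add_mem _ hK _ hL) ?_
  rw [← sub_nonneg, hsub]
  exact add_nonneg (projMatrix_nonneg _) (projMatrix_nonneg _)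

theorem projMatrix_sup_mem (hI : IsPreIsocone I) {K L : Submodule 𝕜 (EuclideanSpace 𝕜 n)}
    (hK : projMatrix K ∈ I) (hL : projMatrix L ∈ I) : projMatrix (K ⊔ L) ∈ I := by
  have hker : (euclideanKer (projMatrix K + projMatrix L))ᗮ = K ⊔ L := by
    rw [euclideanKer_add (projMatrix_nonneg _) (projMatrix_nonneg _), euclideanKer_projMatrix,
      euclideanKer_projMatrix, Submodule.inf_orthogonal, Submodule.orthogonal_orthogonal]
  rw [← hker]
  exact hI.projMatrix_orthogonal_euclideanKer_mem (hI.add_mem _ hK _ hL)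
    (add_nonneg (projMatrix_nonneg _) (projMatrix_nonneg _))

end IsPreIsocone

section PrescribedKernel

variable {n 𝕜 : Type*} [Fintype n] [DecidableEq n] [RCLike 𝕜]

theorem projMatrix_span_singleton (v : EuclideanSpace 𝕜 n) :
    projMatrix (𝕜 ∙ v) = (‖v‖ ^ 2)⁻¹ • vecMulVec v (star v) := by
  refine EquivLike.injective (toEuclideanCLM (n := n) (𝕜 := 𝕜)) ?_
  rw [toEuclideanCLM_projMatrix]
  ext w i
  rw [Submodule.starProjection_singleton, ofLp_toEuclideanCLM, smul_mulVec,
    vecMulVec_mulVec, EuclideanSpace.inner_eq_star_dotProduct]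
  simp [dotProduct_comm, RCLike.real_smul_eq_coe_mul, div_eq_inv_mul, mul_assoc]

theorem continuousAt_projMatrix_span_singleton {v : EuclideanSpace 𝕜 n} (hv : v ≠ 0) :
    ContinuousAt (fun w => projMatrix (𝕜 ∙ w)) v := by
  simp only [projMatrix_span_singleton]
  have hnorm : ContinuousAt (fun w : EuclideanSpace 𝕜 n => (‖w‖ ^ 2)⁻¹) v :=
    (by fun_prop : Continuous fun w : EuclideanSpace 𝕜 n => ‖w‖ ^ 2).continuousAt.inv₀ (by simpa)
  exact hnorm.smul (Continuous.matrix_vecMulVec (by fun_prop) (by fun_prop)).continuousAt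

theorem mul_projMatrix_eq_zero {A : Matrix n n 𝕜} {K : Submodule 𝕜 (EuclideanSpace 𝕜 n)}
    (hK : K ≤ euclideanKer A) : A * projMatrix K = 0 := by
  refine EquivLike.injective (toEuclideanCLM (n := n) (𝕜 := 𝕜)) ?_
  rw [map_mul, toEuclideanCLM_projMatrix, map_zero]
  ext1 x
  exact hK (K.starProjection_apply_mem x)

/-- For `0 ≤ A` and `0 < δ`, a nonnegative matrix with kernel exactly `K`, which is close to `A`
when `δ` is small and `K` is close to a subspace of the kernel of `A`. -/
noncomputable def prescribeKer (A : Matrix n n 𝕜) (K : Submodule 𝕜 (EuclideanSpace 𝕜 n)) (δ : ℝ) :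
    Matrix n n 𝕜 :=
  projMatrix Kᗮ * A * projMatrix Kᗮ + δ • projMatrix Kᗮ

theorem prescribeKer_zero {A : Matrix n n 𝕜} {K : Submodule 𝕜 (EuclideanSpace 𝕜 n)}
    (hA : IsSelfAdjoint A) (hK : K ≤ euclideanKer A) : prescribeKer A K 0 = A := by
  have hright : A * projMatrix K = 0 := mul_projMatrix_eq_zero hK
  have hleft : projMatrix K * A = 0 := by
    rw [← hA.star_eq, ← (isStarProjection_projMatrix K).isSelfAdjoint.star_eq, ← star_mul, hright,
      star_zero]
  rw [prescribeKer, zero_smul, add_zero, projMatrix_orthogonal, sub_mul, hleft, one_mul, sub_zero,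
    mul_sub, hright, mul_one, sub_zero]

theorem compression_nonneg {A : Matrix n n 𝕜} (hA : 0 ≤ A)
    (K : Submodule 𝕜 (EuclideanSpace 𝕜 n)) : 0 ≤ projMatrix K * A * projMatrix K :=
  (isStarProjection_projMatrix K).isSelfAdjoint.conjugate_nonneg hA

theorem prescribeKer_nonneg {A : Matrix n n 𝕜} (hA : 0 ≤ A)
    (K : Submodule 𝕜 (EuclideanSpace 𝕜 n)) {δ : ℝ} (hδ : 0 ≤ δ) : 0 ≤ prescribeKer A K δ :=
  add_nonneg (compression_nonneg hA Kᗮ) (smul_nonneg hδ (projMatrix_nonneg Kᗮ))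

theorem euclideanKer_prescribeKer {A : Matrix n n 𝕜} (hA : 0 ≤ A)
    (K : Submodule 𝕜 (EuclideanSpace 𝕜 n)) {δ : ℝ} (hδ : 0 < δ) :
    euclideanKer (prescribeKer A K δ) = K := by
  have hK : euclideanKer (projMatrix Kᗮ) = K := by
    rw [euclideanKer_projMatrix, Submodule.orthogonal_orthogonal]
  have hsmul : euclideanKer (δ • projMatrix Kᗮ) = K := by
    ext v
    rw [← hK, mem_euclideanKer, mem_euclideanKer, smul_mulVec, smul_eq_zero_iff_right hδ.ne', hK]
  rw [prescribeKer, euclideanKer_add (compression_nonneg hA Kᗮ)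
    (smul_nonneg hδ.le (projMatrix_nonneg _)), hsmul, inf_eq_right]
  exact hK.ge.trans (euclideanKer_le_mul _ _)

theorem continuousAt_prescribeKer_span_singleton (A : Matrix n n 𝕜) {v : EuclideanSpace 𝕜 n}
    (hv : v ≠ 0) (δ : ℝ) :
    ContinuousAt (fun p : ℝ × EuclideanSpace 𝕜 n => prescribeKer A (𝕜 ∙ p.2) p.1) (δ, v) := by
  have hproj : ContinuousAt (fun p : ℝ × EuclideanSpace 𝕜 n => projMatrix (𝕜 ∙ p.2)ᗮ) (δ, v) := by
    simp only [projMatrix_orthogonal]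
    exact continuousAt_const.sub
      ((continuousAt_projMatrix_span_singleton hv).comp_of_eq continuousAt_snd rfl)
  exact ((hproj.mul continuousAt_const).mul hproj).add (continuousAt_fst.smul hproj)

end PrescribedKernel

namespace IsPreIsocone

variable {n 𝕜 : Type*} [Fintype n] [DecidableEq n] [RCLike 𝕜] {I : Set (Matrix n n 𝕜)}

theorem exists_eventually_projMatrix_span_singleton_mem [Nonempty n] (hI : IsPreIsocone I)
    {c : Matrix n n 𝕜} (hcI : c ∈ I) (hc : ∀ᶠ a in 𝓝 c, IsSelfAdjoint a → a ∈ I) :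
    ∃ u : EuclideanSpace 𝕜 n, ∀ᶠ v in 𝓝 u, projMatrix (𝕜 ∙ v) ∈ I := by
  have hsa := hI.isSelfAdjoint c hcI
  obtain ⟨l, hcl, hker⟩ := exists_le_algebraMap_euclideanKer_ne_bot hsa
  obtain ⟨u, hu, hu0⟩ := Submodule.exists_mem_ne_zero_of_ne_bot hker
  set D := algebraMap ℝ (Matrix n n 𝕜) l - c
  have hD : 0 ≤ D := sub_nonneg.2 hcl
  have hpert : Tendsto (fun p : ℝ × EuclideanSpace 𝕜 n =>
      algebraMap ℝ _ l - prescribeKer D (𝕜 ∙ p.2) p.1) (𝓝 (0, u)) (𝓝 c) := by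
    have hlim := (continuousAt_prescribeKer_span_singleton D hu0 0).tendsto.const_sub
      (algebraMap ℝ _ l)
    rwa [prescribeKer_zero hD.isSelfAdjoint
      ((Submodule.span_singleton_le_iff_mem _ _).2 hu), sub_sub_cancel] at hlim
  obtain ⟨δ, hmem, hδ⟩ := ((hpert.eventually hc).curry_nhds.filter_mono
    (nhdsWithin_le_nhds (s := Ioi 0)) |>.and self_mem_nhdsWithin).exists
  refine ⟨u, ?_⟩
  filter_upwards [hmem] with v hv
  have hpos : 0 ≤ prescribeKer D (𝕜 ∙ v) δ := prescribeKer_nonneg hD _ (le_of_lt hδ)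
  have htop := hI.projMatrix_euclideanKer_mem
    (hv ((IsSelfAdjoint.algebraMap _ (.all l)).sub hpos.isSelfAdjoint)) (sub_le_self _ hpos)
  rwa [sub_sub_cancel, euclideanKer_prescribeKer hD _ hδ] at htop

theorem projMatrix_span_pair_mem (hI : IsPreIsocone I) {v : EuclideanSpace 𝕜 n}
    (hv : ∀ᶠ w in 𝓝 v, projMatrix (𝕜 ∙ w) ∈ I) (x : EuclideanSpace 𝕜 n) :
    projMatrix (Submodule.span 𝕜 {x, v}) ∈ I := by
  have hpert : Tendsto (fun ε : 𝕜 => ε • x + v) (𝓝[≠] 0) (𝓝 v) := by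
    have hcont : Continuous fun ε : 𝕜 => ε • x + v := by fun_prop
    simpa using (hcont.tendsto 0).mono_left nhdsWithin_le_nhds
  obtain ⟨ε, hmem, hε⟩ := ((hpert.eventually hv).and self_mem_nhdsWithin).exists
  have hspan : Submodule.span 𝕜 {x, v} = (𝕜 ∙ (ε • x + v)) ⊔ (𝕜 ∙ v) := by
    rw [← Submodule.span_insert]
    refine Submodule.span_eq_span ?_ ?_ <;> rw [insert_subset_iff, singleton_subset_iff]
    · have hx : ε⁻¹ • (ε • x + v) + -ε⁻¹ • v = x := by
        rw [smul_add, inv_smul_smul₀ hε, neg_smul, add_neg_cancel_right]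
      exact ⟨Submodule.mem_span_pair.2 ⟨_, _, hx⟩, Submodule.subset_span (by simp)⟩
    · exact ⟨Submodule.mem_span_pair.2 ⟨ε, 1, by rw [one_smul]⟩, Submodule.subset_span (by simp)⟩
  rw [hspan]
  exact hI.projMatrix_sup_mem hmem hv.self_of_nhds

theorem projMatrix_span_singleton_mem (hI : IsPreIsocone I) (hn : 3 ≤ Fintype.card n)
    {u : EuclideanSpace 𝕜 n} (hu : ∀ᶠ v in 𝓝 u, projMatrix (𝕜 ∙ v) ∈ I)
    (x : EuclideanSpace 𝕜 n) : projMatrix (𝕜 ∙ x) ∈ I := by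
  have hproper : Submodule.span 𝕜 {x, u} ≠ ⊤ := by
    intro htop
    have hle := finrank_range_le_card (R := 𝕜) ![x, u]
    rw [Matrix.range_cons_cons_empty, Set.finrank, htop, finrank_top, finrank_euclideanSpace,
      Fintype.card_fin] at hle
    omega
  obtain ⟨w, hw, hwmem⟩ : ∃ w, (∀ᶠ v in 𝓝 w, projMatrix (𝕜 ∙ v) ∈ I) ∧
      w ∉ Submodule.span 𝕜 {x, u} := by
    by_contra! hsub
    exact hproper (Submodule.eq_top_of_nonempty_interior' _
      ⟨u, mem_interior_iff_mem_nhds.2 (hu.eventually_nhds.mono hsub)⟩)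
  have hinf : Submodule.span 𝕜 {x, w} ⊓ Submodule.span 𝕜 {x, u} = 𝕜 ∙ x := by
    rw [Submodule.span_insert x {w}, sup_inf_assoc_of_le _ (Submodule.span_mono (by simp)),
      (Submodule.disjoint_span_singleton_of_notMem hwmem).symm.eq_bot, sup_bot_eq]
  rw [← hinf]
  exact hI.projMatrix_inf_mem (hI.projMatrix_span_pair_mem hw x) (hI.projMatrix_span_pair_mem hu x)

theorem mem_of_nonneg (hI : IsPreIsocone I)
    (hline : ∀ x : EuclideanSpace 𝕜 n, projMatrix (𝕜 ∙ x) ∈ I) {A : Matrix n n 𝕜} (hA : 0 ≤ A) :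
    A ∈ I := by
  obtain ⟨m, v, rfl⟩ := posSemidef_iff_eq_sum_vecMulVec.1 hA.posSemidef
  refine hI.sum_mem _ fun i _ => ?_
  set x : EuclideanSpace 𝕜 n := WithLp.toLp 2 (v i)
  have hx : vecMulVec (v i) (star (v i)) = ‖x‖ ^ 2 • projMatrix (𝕜 ∙ x) := by
    rcases eq_or_ne x 0 with h | h
    · simp [h, (WithLp.toLp_eq_zero 2).1 h]
    · rw [projMatrix_span_singleton, smul_inv_smul₀ (by simpa)]
  rw [hx]
  exact hI.smul_mem (by positivity) (hline x)

theorem mem_of_isSelfAdjoint (hI : IsPreIsocone I)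
    (hline : ∀ x : EuclideanSpace 𝕜 n, projMatrix (𝕜 ∙ x) ∈ I) {A : Matrix n n 𝕜}
    (hA : IsSelfAdjoint A) : A ∈ I := by
  obtain ⟨r, hr⟩ := A.finite_real_spectrum.bddBelow
  have hrA : algebraMap ℝ _ r ≤ A := algebraMap_le_of_le_spectrum fun t ht => hr ht
  simpa using hI.add_mem _ (hI.mem_of_nonneg hline (sub_nonneg.2 hrA)) _ (hI.const_mem r)

end IsPreIsocone

theorem mainTheorem2_general {n 𝕜 : Type*} [Fintype n] [DecidableEq n] [RCLike 𝕜]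
    (hn : 3 ≤ Fintype.card n) (I : Set (Matrix n n 𝕜)) :
    IsIsocone I ↔ I = {A : Matrix n n 𝕜 | A.IsHermitian} := by
  have : Nonempty n := Fintype.card_pos_iff.1 (by omega)
  refine ⟨fun hI => Subset.antisymm hI.isSelfAdjoint fun A hA => ?_, ?_⟩
  · obtain ⟨c, hcI, hc⟩ := hI.exists_eventually_isSelfAdjoint_mem
    obtain ⟨u, hu⟩ := hI.exists_eventually_projMatrix_span_singleton_mem hcI hc
    exact hI.mem_of_isSelfAdjoint (hI.projMatrix_span_singleton_mem hn hu) hA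
  · rintro rfl
    exact isIsocone_isSelfAdjoint

theorem mainTheorem2 (N : ℕ) (hN : 3 ≤ N) (I : Set (Matrix (Fin N) (Fin N) ℂ)) :
    IsIsocone I ↔ I = Herm N :=
  mainTheorem2_general (by simpa using hN) I
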